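/- Let $S$ be an integral domain which is not a field, let $F$ be its field of fractions, and let $A$ be a commutative (unital) $F$-algebra such that the structure map $F\to A$ is not surjective (in particular $A\ne 0$, so that $S\subseteq F\subsetneq A$ after identifying $F$ and $S$ with their images in $A$). A basis $B$ of $A$ over $F$ is called $S$-stable if there is a basis $C$ of $A$ over $F$ such that $cb\in\sum_{y\in B}Sy$ for all $c\in C$ and $b\in B$. An $S$-subalgebra $R$ of $A$ is called $S$-nice if $R\cap F=S$ and $RF=A$, where $RF$ denotes the $F$-linear span of $R$. Let $\mathcal C$ be a chain (a set totally ordered by inclusion) of prime ideals of $S$. A chain $\mathcal D$ of prime ideals of an $S$-subalgebra $R$ of $A$ is said to cover $\mathcal C$ if for every $P\in\mathcal C$ there exists $Q\in\mathcal D$ with $Q\cap S=P$. Assume that there exists an $S$-stable basis of $A$ over $F$. Then for every chain $\mathcal C$ of prime ideals of $S$ there exists an $S$-nice subalgebra $R$ of $A$ that has a chain of prime ideals covering $\mathcal C$. In fact, there exists an infinite strictly descending chain $R_0\supsetneq R_1\supsetneq R_2\supsetneq\cdots$ of $S$-nice subalgebras of $A$, each of which has a chain of prime ideals covering $\mathcal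 C$. -/

import Mathlib

/-- A subset `B` of an `F`-vector space `A` that is a basis of `A` over `F`. -/
structure IsBasisSet (F : Type*) {A : Type*} [Field F] [AddCommGroup A] [Module F A]
    (B : Set A) : Prop where
  linearIndep : LinearIndepOn F id B
  span_eq_top : Submodule.span F B = ⊤

/-- The basis `C` of `A` over `F` stabilizes `B`: one has `c * b ∈ ∑_{y ∈ B} S y` for all
`c ∈ C` and `b ∈ B`. -/
structure Stabilizes (S F : Type*) {A : Type*} [CommRing S] [Field F] [Ring A]
    [Algebra S A] [Algebra F A] (C B : Set A) : Prop where
  isBasisSet : IsBasisSet F C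
  mul_mem : ∀ c ∈ C, ∀ b ∈ B, c * b ∈ Submodule.span S B

/-- `B` is an `S`-stable basis of `A` over `F`. -/
structure IsStableBasis (S F : Type*) {A : Type*} [CommRing S] [Field F] [Ring A]
    [Algebra S A] [Algebra F A] (B : Set A) : Prop where
  isBasisSet : IsBasisSet F B
  exists_stabilizes : ∃ C : Set A, Stabilizes S F C B

/-- `R` is an `S`-nice subalgebra of `A`: `R ∩ F = S` and `R F = A`, where `S` and `F` are
identified with their images in `A`. -/
structure IsNice {S : Type*} (F : Type*) {A : Type*} [CommRing S] [Field F] [Ring A]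
    [Algebra S A] [Algebra F A] (R : Subalgebra S A) : Prop where
  inter_eq : (R : Set A) ∩ Set.range (algebraMap F A) = Set.range (algebraMap S A)
  span_eq_top : Submodule.span F (R : Set A) = ⊤

/-- A set `D` of prime ideals of the `S`-algebra `R` covers a set `C` of prime ideals of `S`:
every `P ∈ C` is of the form `Q ∩ S` for some `Q ∈ D`. -/
def Covers {S R : Type*} [CommRing S] [CommRing R] [Algebra S R]
    (D : Set (PrimeSpectrum R)) (C : Set (PrimeSpectrum S)) : Prop :=
  ∀ P ∈ C, ∃ Q ∈ D, Q.asIdeal.LiesOver P.asIdeal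

/-- The `S`-algebra `R` has a chain of prime ideals covering `C`. -/
def HasCoveringChain {S : Type*} (R : Type*) [CommRing S] [CommRing R] [Algebra S R]
    (C : Set (PrimeSpectrum S)) : Prop :=
  ∃ D : Set (PrimeSpectrum R), IsChain (· ≤ ·) D ∧ Covers D C

/-! Let M be the S-span of the stable basis and R₀ the ring of elements of A multiplying M into
itself. Since M is free and nonzero, R₀ ∩ F = S; since R₀ contains the stabilizing basis, R₀F = A. A
finite chain of primes lifts to any S-algebra acting on a nonzero free S-module: the multiplicative
set built from the chain omits 0, because its elements do not kill a basis vector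
(`exists_repr_smul_notMem`), and primes can then be chosen one above another
(`exists_lift_of_disjoint`). An ultrafilter limit handles infinite chains. Contraction passes the
lifted chain to subalgebras of R₀, and any nice R ≤ R₀ strictly contains the nice algebra S + sR for
some s ≠ 0. -/

/-- The multiplicative set of elements `u * w + x` with `u ∉ P`, `w ∈ W`, `x ∈ P R`. -/
def primeExtension {S R : Type*} [CommRing S] [CommRing R] [Algebra S R]
    (P : PrimeSpectrum S) (W : Submonoid R) : Submonoid R where
  carrier := {z | ∃ u ∉ P.asIdeal, ∃ w ∈ W, ∃ x ∈ P.asIdeal.map (algebraMap S R),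
    z = algebraMap S R u * w + x}
  one_mem' := ⟨1, P.asIdeal.one_notMem, 1, W.one_mem, 0, Ideal.zero_mem _, by simp⟩
  mul_mem' := by
    rintro _ _ ⟨u, hu, w, hw, x, hx, rfl⟩ ⟨u', hu', w', hw', x', hx', rfl⟩
    refine ⟨u * u', fun h => (P.2.mem_or_mem h).elim hu hu', w * w', W.mul_mem hw hw',
      algebraMap S R u * w * x' + (algebraMap S R u' * w' + x') * x,
      Ideal.add_mem _ (Ideal.mul_mem_left _ _ hx') (Ideal.mul_mem_left _ _ hx), ?_⟩
    rw [map_mul]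
    ring

/-- The iterated extension of the trivial monoid along a list of primes. -/
def listExtension {S : Type*} (R : Type*) [CommRing S] [CommRing R] [Algebra S R]
    {ι : Type*} (p : ι → PrimeSpectrum S) : List ι → Submonoid R
  | [] => ⊥
  | i :: l => primeExtension (p i) (listExtension R p l)

/-- An ideal that avoids the iterated extension along a sorted list of primes extends to a chain
of primes lying over that list. -/
theorem exists_lift_of_disjoint {S R ι : Type*} [CommRing S] [CommRing R] [Algebra S R]
    [LinearOrder ι] (p : ι → PrimeSpectrum S) (l : List ι) (hl : l.Pairwise (· < ·))
    (J : Ideal R) (hJ : Disjoint (J : Set R) (listExtension R p l)) :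
    ∃ q : ι → Ideal R, (∀ i ∈ l, J ≤ q i ∧ (q i).IsPrime ∧ (q i).LiesOver (p i).asIdeal) ∧
      ∀ i ∈ l, ∀ j ∈ l, i ≤ j → q i ≤ q j := by
  induction l generalizing J with
  | nil => exact ⟨fun _ => J, by simp, by simp⟩
  | cons i l ih =>
    rw [List.pairwise_cons] at hl
    set W := listExtension R p l with hW
    set I := J ⊔ (p i).asIdeal.map (algebraMap S R) with hI
    -- Avoiding the image of S \ P forces Q ∩ S ⊆ P; avoiding W lets the induction continue with Q
    -- in place of J.
    set U := (p i).asIdeal.primeCompl.map (algebraMap S R) ⊔ W with hU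
    have hdisj : Disjoint (I : Set R) U := by
      rw [Set.disjoint_left]
      intro z hz hzU
      obtain ⟨_, ⟨u, hu, rfl⟩, w, hw, rfl⟩ := Submonoid.mem_sup.1 hzU
      obtain ⟨y, hy, x, hx, hyx⟩ := Submodule.mem_sup.1 hz
      refine Set.disjoint_left.1 hJ hy ⟨u, hu, w, hw, -x, neg_mem hx, ?_⟩
      rw [← sub_eq_add_neg]
      exact eq_sub_of_add_eq hyx
    obtain ⟨Q, hQ, hIQ, hQU⟩ := Ideal.exists_le_prime_disjoint I U hdisj
    have hQW : Disjoint (Q : Set R) W :=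
      hQU.mono_right (SetLike.coe_subset_coe.2 le_sup_right)
    obtain ⟨q, hq, hqm⟩ := ih hl.2 Q hQW
    have hne : ∀ j ∈ l, j ≠ i := fun j hj => (hl.1 j hj).ne'
    have hover : Q.LiesOver (p i).asIdeal := by
      refine ⟨le_antisymm ?_ ?_⟩
      · exact Ideal.map_le_iff_le_comap.1 (le_sup_right.trans hIQ)
      · intro s hs
        by_contra hsp
        exact Set.disjoint_left.1 hQU hs
          (Submonoid.mem_sup_left (Submonoid.mem_map_of_mem (algebraMap S R) hsp))
    have hJQ : J ≤ Q := le_sup_left.trans hIQ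
    refine ⟨Function.update q i Q, ?_, ?_⟩
    · intro j hj
      rcases List.mem_cons.1 hj with rfl | hj
      · simpa using ⟨hJQ, hQ, hover⟩
      · rw [Function.update_of_ne (hne j hj)]
        exact ⟨hJQ.trans (hq j hj).1, (hq j hj).2⟩
    · intro j hj k hk hjk
      rcases List.mem_cons.1 hj with rfl | hj' <;> rcases List.mem_cons.1 hk with rfl | hk'
      · exact le_rfl
      · rw [Function.update_self, Function.update_of_ne (hne k hk')]
        exact (hq k hk').1
      · exact absurd (hl.1 j hj') hjk.not_gt
      · rw [Function.update_of_ne (hne j hj'), Function.update_of_ne (hne k hk')]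
        exact hqm j hj' k hk' hjk

/-! ### Lifting chains to algebras acting on free modules -/

section FreeModule

variable {S R M ι κ : Type*} [CommRing S] [CommRing R] [Algebra S R]
  [AddCommGroup M] [Module R M] [Module S M] [IsScalarTower S R M]

theorem repr_smul_mem_of_mem_map (e : Module.Basis κ S M) (P : Ideal S) {x : R}
    (hx : x ∈ P.map (algebraMap S R)) (m : M) (k : κ) : e.repr (x • m) k ∈ P := by
  induction hx using Submodule.span_induction generalizing m with
  | mem x hx =>
    obtain ⟨s, hs, rfl⟩ := hx
    rw [algebraMap_smul, map_smul]
    exact P.mul_mem_right _ hs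
  | zero => simp
  | add x y _ _ hx hy =>
    rw [add_smul, map_add]
    exact P.add_mem (hx m) (hy m)
  | smul r x _ hx =>
    rw [smul_eq_mul, mul_comm, mul_smul]
    exact hx _

/-- Elements of the iterated extension do not move a basis vector into `P M`. -/
theorem exists_repr_smul_notMem [LinearOrder ι] (e : Module.Basis κ S M) (b : κ)
    {p : ι → PrimeSpectrum S} (hp : Monotone p) (l : List ι) (hl : l.Pairwise (· < ·))
    (P : PrimeSpectrum S) (hP : ∀ i ∈ l, P ≤ p i) {w : R} (hw : w ∈ listExtension R p l) :
    ∃ k, e.repr (w • e b) k ∉ P.asIdeal := by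
  induction l generalizing P w with
  | nil =>
    obtain rfl : w = 1 := hw
    exact ⟨b, by simpa using P.asIdeal.one_notMem⟩
  | cons i l ih =>
    rw [List.pairwise_cons] at hl
    obtain ⟨u, hu, w, hw, x, hx, rfl⟩ := hw
    obtain ⟨k, hk⟩ := ih hl.2 (p i) (fun j hj => hp (hl.1 j hj).le) hw
    refine ⟨k, fun h => ?_⟩
    -- Modulo the larger prime `p i` the term x acts as zero, and u cancels by primality.
    have h' : e.repr ((algebraMap S R u * w + x) • e b) k ∈ (p i).asIdeal :=
      hP i (by simp) h
    rw [add_smul, mul_smul, algebraMap_smul, map_add, map_smul, Finsupp.add_apply] at h'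
    have h'' := (Ideal.add_mem_iff_left _
      (repr_smul_mem_of_mem_map e (p i).asIdeal hx (e b) k)).1 h'
    exact ((p i).2.mem_or_mem h'').elim hu hk

/-- Chains of primes of a domain `S` lift to every commutative `S`-algebra that acts on a nonzero
free `S`-module. -/
theorem exists_monotone_lift [IsDomain S] [LinearOrder ι] (e : Module.Basis κ S M) (b : κ)
    {p : ι → PrimeSpectrum S} (hp : Monotone p) :
    ∃ q : ι → PrimeSpectrum R, Monotone q ∧ ∀ i, (q i).asIdeal.LiesOver (p i).asIdeal := by
  have hfin : ∀ s : Finset ι, ∃ q : ι → Ideal R,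
      (∀ i ∈ s, (q i).IsPrime ∧ (q i).LiesOver (p i).asIdeal) ∧
      ∀ i ∈ s, ∀ j ∈ s, i ≤ j → q i ≤ q j := by
    intro s
    have hs : (s.sort (· ≤ ·)).Pairwise (· < ·) := s.sortedLT_sort.pairwise
    obtain ⟨q, hq, hqm⟩ := exists_lift_of_disjoint p (s.sort (· ≤ ·)) hs (⊥ : Ideal R) (by
      rw [Set.disjoint_left]
      rintro z rfl hz
      obtain ⟨k, hk⟩ := exists_repr_smul_notMem e b hp _ hs ⊥ (fun _ _ => bot_le) hz
      simp at hk)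
    simp only [Finset.mem_sort] at hq hqm
    exact ⟨q, fun i hi => (hq i hi).2, hqm⟩
  choose q hq hqm using hfin
  -- Refining `atTop` makes each index eventually belong to s; the ultrafilter property makes the
  -- limit ideals prime.
  let 𝒰 : Ultrafilter (Finset ι) := Ultrafilter.of Filter.atTop
  have hmem : ∀ i, ∀ᶠ s in (𝒰 : Filter (Finset ι)), i ∈ s := fun i =>
    Ultrafilter.of_le _ ((Filter.eventually_ge_atTop {i}).mono fun s hs => by simpa using hs)
  let Q : ι → Ideal R := fun i =>
    { carrier := {r | ∀ᶠ s in (𝒰 : Filter (Finset ι)), r ∈ q s i}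
      zero_mem' := Filter.Eventually.of_forall fun s => (q s i).zero_mem
      add_mem' := fun hx hy => by
        filter_upwards [hx, hy] with s hs hs' using (q s i).add_mem hs hs'
      smul_mem' := fun r x hx => by
        filter_upwards [hx] with s hs using (q s i).mul_mem_left r hs }
  have hQ : ∀ i r, r ∈ Q i ↔ ∀ᶠ s in (𝒰 : Filter (Finset ι)), r ∈ q s i := fun _ _ => Iff.rfl
  have hprime : ∀ i, (Q i).IsPrime := by
    intro i
    refine ⟨fun h => ?_, fun {x y} hxy => ?_⟩
    · have h1 : (1 : R) ∈ Q i := h ▸ Submodule.mem_top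
      obtain ⟨s, hs, his⟩ := (((hQ i 1).1 h1).and (hmem i)).exists
      exact (hq s i his).1.one_notMem hs
    · rw [hQ, hQ, ← Ultrafilter.eventually_or]
      filter_upwards [(hQ i _).1 hxy, hmem i] with s hs his
      exact (hq s i his).1.mem_or_mem hs
  refine ⟨fun i => ⟨Q i, hprime i⟩, fun i j hij x hx => ?_, fun i => ⟨?_⟩⟩
  · refine (hQ j x).2 ?_
    filter_upwards [(hQ i x).1 hx, hmem i, hmem j] with s hs hi hj
    exact hqm s i hi j hj hij hs
  · ext x
    have key : ∀ s, i ∈ s → (x ∈ (p i).asIdeal ↔ algebraMap S R x ∈ q s i) := fun s his => by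
      rw [(hq s i his).2.over]
      rfl
    constructor
    · intro hx
      refine (hQ i _).2 ?_
      filter_upwards [hmem i] with s his using (key s his).1 hx
    · intro hx
      obtain ⟨s, hs, his⟩ := (((hQ i _).1 hx).and (hmem i)).exists
      exact (key s his).2 hs

theorem hasCoveringChain_of_basis [IsDomain S] (e : Module.Basis κ S M) (b : κ)
    {C : Set (PrimeSpectrum S)} (hC : IsChain (· ≤ ·) C) : HasCoveringChain R C := by
  classical
  let _ : LinearOrder C :=
    { (inferInstance : PartialOrder C) with
      le_total := fun x y => hC.total x.2 y.2
      toDecidableLE := Classical.decRel _ }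
  obtain ⟨q, hq, hqo⟩ := exists_monotone_lift (R := R) e b
    (p := fun i : C => (i : PrimeSpectrum S)) (fun _ _ h => h)
  refine ⟨Set.range q, ?_, fun P hP => ⟨q ⟨P, hP⟩, ⟨_, rfl⟩, hqo ⟨P, hP⟩⟩⟩
  rintro _ ⟨i, rfl⟩ _ ⟨j, rfl⟩ -
  exact (le_total i j).imp (fun h => hq h) fun h => hq h

end FreeModule

/-- Contraction along f preserves inclusions and the trace on S. -/
theorem HasCoveringChain.of_algHom {S R R' : Type*} [CommRing S] [CommRing R] [CommRing R']
    [Algebra S R] [Algebra S R'] (f : R →ₐ[S] R') {C : Set (PrimeSpectrum S)}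
    (h : HasCoveringChain R' C) : HasCoveringChain R C := by
  obtain ⟨D, hD, hDC⟩ := h
  refine ⟨PrimeSpectrum.comap (f : R →+* R') '' D, ?_, fun P hP => ?_⟩
  · rintro _ ⟨x, hx, rfl⟩ _ ⟨y, hy, rfl⟩ -
    exact (hD.total hx hy).imp (fun h => Ideal.comap_mono h) fun h => Ideal.comap_mono h
  · obtain ⟨Q, hQ, hQP⟩ := hDC P hP
    refine ⟨_, ⟨Q, hQ, rfl⟩, ⟨?_⟩⟩
    rw [hQP.over]
    ext x
    simp [Ideal.under]

/-! ### Nice subalgebras and strict descent -/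

section Nice

variable {S F A : Type*} [CommRing S] [Field F] [Algebra S F] [CommRing A] [Algebra F A]
  [Algebra S A] [IsScalarTower S F A]

/-- The subalgebra of the elements that multiply `M` into itself. -/
def multiplierSubalgebra (M : Submodule S A) : Subalgebra S A where
  carrier := {a | ∀ m ∈ M, a * m ∈ M}
  mul_mem' := fun {a b} ha hb m hm => by
    rw [mul_assoc]
    exact ha _ (hb m hm)
  add_mem' := fun {a b} ha hb m hm => by
    rw [add_mul]
    exact M.add_mem (ha m hm) (hb m hm)
  algebraMap_mem' := fun s m hm => by
    rw [← Algebra.smul_def]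
    exact M.smul_mem s hm

/-- `M` as a module over its multiplier subalgebra. -/
def multiplierSubmodule (M : Submodule S A) : Submodule (multiplierSubalgebra M) A where
  carrier := M
  add_mem' := M.add_mem
  zero_mem' := M.zero_mem
  smul_mem' := fun a m hm => a.2 m hm

theorem hasCoveringChain_multiplierSubalgebra [IsDomain S] [FaithfulSMul S F] {κ : Type*}
    (e : Module.Basis κ F A) (b : κ) {C : Set (PrimeSpectrum S)} (hC : IsChain (· ≤ ·) C) :
    HasCoveringChain (multiplierSubalgebra (Submodule.span S (Set.range e))) C := by
  have hli : LinearIndependent S e := e.linearIndependent.restrict_scalars' S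
  let e' : Module.Basis κ S
      (multiplierSubmodule (Submodule.span S (Set.range e))) := Module.Basis.span hli
  exact hasCoveringChain_of_basis e' b hC

theorem isNice_multiplierSubalgebra [IsDomain S] [FaithfulSMul S F] {κ : Type*}
    (e : Module.Basis κ F A) (b : κ) {C : Set A} (hC : Stabilizes S F C (Set.range e)) :
    IsNice F (multiplierSubalgebra (Submodule.span S (Set.range e))) where
  inter_eq := by
    refine Set.Subset.antisymm ?_ ?_
    · rintro _ ⟨hf, f, rfl⟩
      -- The coefficient of f • e b at b is f itself, so it must come from S.
      have h := hf (e b) (Submodule.subset_span ⟨b, rfl⟩)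
      rw [← Algebra.smul_def, Module.Basis.mem_span_iff_repr_mem] at h
      obtain ⟨s, hs⟩ := h b
      refine ⟨s, ?_⟩
      rw [IsScalarTower.algebraMap_apply S F A, hs]
      simp
    · rintro _ ⟨s, rfl⟩
      exact ⟨Subalgebra.algebraMap_mem _ s, algebraMap S F s,
        (IsScalarTower.algebraMap_apply S F A s).symm⟩
  span_eq_top := by
    rw [eq_top_iff, ← hC.isBasisSet.span_eq_top]
    refine Submodule.span_mono fun c hc m hm => ?_
    induction hm using Submodule.span_induction with
    | mem x hx => exact hC.mul_mem c hc x hx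
    | zero => simp
    | add x y _ _ hx hy =>
      rw [mul_add]
      exact Submodule.add_mem _ hx hy
    | smul s x _ hx =>
      rw [mul_smul_comm]
      exact Submodule.smul_mem _ s hx

/-- The subalgebra `S + s R`. -/
def conductorSubalgebra (R : Subalgebra S A) (s : S) : Subalgebra S A where
  carrier := {x | ∃ c : S, ∃ r ∈ R, x = algebraMap S A c + s • r}
  mul_mem' := by
    rintro _ _ ⟨c, r, hr, rfl⟩ ⟨c', r', hr', rfl⟩
    refine ⟨c * c', c • r' + c' • r + s • (r * r'), R.add_mem (R.add_mem (R.smul_mem hr' c)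
      (R.smul_mem hr c')) (R.smul_mem (R.mul_mem hr hr') s), ?_⟩
    simp only [Algebra.smul_def, map_mul]
    ring
  add_mem' := by
    rintro _ _ ⟨c, r, hr, rfl⟩ ⟨c', r', hr', rfl⟩
    refine ⟨c + c', r + r', R.add_mem hr hr', ?_⟩
    rw [map_add, smul_add]
    abel
  algebraMap_mem' := fun c => ⟨c, 0, R.zero_mem, by simp⟩

theorem conductorSubalgebra_le (R : Subalgebra S A) (s : S) : conductorSubalgebra R s ≤ R := by
  rintro _ ⟨c, r, hr, rfl⟩
  exact R.add_mem (R.algebraMap_mem c) (R.smul_mem hr s)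

theorem IsNice.conductorSubalgebra [FaithfulSMul S F] {R : Subalgebra S A} (hR : IsNice F R)
    {s : S} (hs : s ≠ 0) : IsNice F (conductorSubalgebra R s) where
  inter_eq := by
    refine Set.Subset.antisymm ?_ ?_
    · rw [← hR.inter_eq]
      exact Set.inter_subset_inter_left _ (conductorSubalgebra_le R s)
    · rintro _ ⟨c, rfl⟩
      exact ⟨Subalgebra.algebraMap_mem _ c, algebraMap S F c,
        (IsScalarTower.algebraMap_apply S F A c).symm⟩
  span_eq_top := by
    rw [eq_top_iff, ← hR.span_eq_top, Submodule.span_le]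
    intro r hr
    have hs' : algebraMap S F s ≠ 0 := by
      simpa using (FaithfulSMul.algebraMap_injective S F).ne hs
    have h : s • r ∈ _root_.conductorSubalgebra R s := ⟨0, r, hr, by simp⟩
    have h' := Submodule.smul_mem _ (algebraMap S F s)⁻¹
      (Submodule.subset_span (R := F) (SetLike.mem_coe.2 h))
    rwa [← algebraMap_smul F s r, inv_smul_smul₀ hs'] at h'

/-- An element divisible by every nonzero element of a domain that is not a field is zero. -/
theorem eq_zero_of_forall_dvd [IsDomain S] (hS : ¬ IsField S) {x : S}
    (hx : ∀ s : S, s ≠ 0 → s ∣ x) : x = 0 := by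
  by_contra h
  obtain ⟨s, hs, hsu⟩ := Ring.exists_not_isUnit_of_not_isField hS
  -- Cancelling x from x = x * s * c would make the nonunit s invertible.
  obtain ⟨c, hc⟩ := hx (x * s) (mul_ne_zero h hs)
  refine hsu (IsUnit.of_mul_eq_one c (mul_left_cancel₀ h ?_))
  rw [← mul_assoc, ← hc, mul_one]

/-- If R = S + sR for every s ≠ 0, each element of R acts on the basis by a matrix over S that is
scalar modulo every s, hence scalar. Then R ⊆ F, so A = RF is the image of F. -/
theorem exists_conductorSubalgebra_lt [IsDomain S] (hS : ¬ IsField S) [FaithfulSMul S F]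
    (hA : ¬ Function.Surjective (algebraMap F A)) {κ : Type*} (e : Module.Basis κ F A) (b : κ)
    {R : Subalgebra S A} (hR : IsNice F R)
    (hRM : R ≤ multiplierSubalgebra (Submodule.span S (Set.range e))) :
    ∃ s : S, s ≠ 0 ∧ conductorSubalgebra R s < R := by
  by_contra! hcon
  have hdiv : ∀ s : S, s ≠ 0 → ∀ r ∈ R, ∃ c : S, ∃ r' ∈ R, r = algebraMap S A c + s • r' :=
    fun s hs r hr => by
      by_contra h
      exact hcon s hs ((conductorSubalgebra_le R s).lt_of_not_ge fun hle => h (hle hr))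
  have hint : ∀ r ∈ R, ∀ j k, ∃ c : S, algebraMap S F c = e.repr (r * e j) k :=
    fun r hr j k => (e.mem_span_iff_repr_mem S _).1
      (hRM hr (e j) (Submodule.subset_span ⟨j, rfl⟩)) k
  have hinj := FaithfulSMul.algebraMap_injective S F
  have hrepr : ∀ (c s : S) (r : A) (j k : κ),
      e.repr ((algebraMap S A c + s • r) * e j) k =
        algebraMap S F c * e.repr (e j) k + algebraMap S F s * e.repr (r * e j) k := by
    intro c s r j k
    rw [add_mul, smul_mul_assoc, ← Algebra.smul_def, ← algebraMap_smul F c,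
      ← algebraMap_smul F s, map_add, map_smul, map_smul]
    rfl
  have hoff : ∀ r ∈ R, ∀ j k, j ≠ k → e.repr (r * e j) k = 0 := by
    intro r hr j k hjk
    obtain ⟨x, hx⟩ := hint r hr j k
    rw [← hx, eq_zero_of_forall_dvd hS (x := x), map_zero]
    intro s hs
    obtain ⟨c, r', hr', rfl⟩ := hdiv s hs r hr
    obtain ⟨y, hy⟩ := hint r' hr' j k
    refine ⟨y, hinj ?_⟩
    rw [hx, hrepr, ← hy, map_mul]
    simp [hjk]
  have hdiag : ∀ r ∈ R, ∀ j, e.repr (r * e j) j = e.repr (r * e b) b := by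
    intro r hr j
    obtain ⟨x, hx⟩ := hint r hr j j
    obtain ⟨z, hz⟩ := hint r hr b b
    rw [← hx, ← hz, ← sub_eq_zero, ← map_sub,
      eq_zero_of_forall_dvd hS (x := x - z), map_zero]
    intro s hs
    obtain ⟨c, r', hr', rfl⟩ := hdiv s hs r hr
    obtain ⟨y, hy⟩ := hint r' hr' j j
    obtain ⟨y', hy'⟩ := hint r' hr' b b
    refine ⟨y - y', hinj ?_⟩
    rw [map_sub, hx, hz, hrepr, hrepr, ← hy, ← hy', map_mul, map_sub]
    simp only [Module.Basis.repr_self, Finsupp.single_eq_same]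
    ring
  -- Multiplication by r agrees with a scalar on the basis, hence at 1.
  have hRF : ∀ r ∈ R, r = algebraMap F A (e.repr (r * e b) b) := by
    intro r hr
    have h : LinearMap.mulLeft F r =
        LinearMap.mulLeft F (algebraMap F A (e.repr (r * e b) b)) := by
      refine e.ext fun j => e.repr.injective (Finsupp.ext fun k => ?_)
      rw [LinearMap.mulLeft_apply, LinearMap.mulLeft_apply, ← Algebra.smul_def, map_smul]
      by_cases hjk : j = k
      · subst hjk
        simp [hdiag r hr j]
      · simp [hoff r hr j k hjk, hjk]
    simpa using LinearMap.congr_fun h 1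
  refine hA fun a => ?_
  have ha : a ∈ Submodule.span F (R : Set A) := hR.span_eq_top ▸ Submodule.mem_top
  have hle : Submodule.span F (R : Set A) ≤ LinearMap.range (Algebra.linearMap F A) :=
    Submodule.span_le.2 fun r hr => ⟨_, (hRF r hr).symm⟩
  exact hle ha

end Nice

theorem mainTheorem5 {S F A : Type*} [CommRing S] [IsDomain S] (hS : ¬ IsField S)
    [Field F] [Algebra S F] [IsFractionRing S F]
    [CommRing A] [Algebra F A] [Algebra S A] [IsScalarTower S F A]
    (hA : ¬ Function.Surjective (algebraMap F A))
    (hB : ∃ B : Set A, IsStableBasis S F B)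
    (C : Set (PrimeSpectrum S)) (hC : IsChain (· ≤ ·) C) :
    (∃ R : Subalgebra S A, IsNice F R ∧ HasCoveringChain R C) ∧
    ∃ R : ℕ → Subalgebra S A, StrictAnti R ∧
      ∀ n, IsNice F (R n) ∧ HasCoveringChain (R n) C := by
  obtain ⟨B, ⟨hBli, hBspan⟩, K, hK⟩ := hB
  have hli : LinearIndependent F ((↑) : B → A) := hBli
  let e : Module.Basis B F A := Module.Basis.mk hli (by rw [Subtype.range_coe, hBspan])
  have he : Set.range e = B := by
    rw [Module.Basis.coe_mk, Subtype.range_coe]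
  have : Nontrivial A := not_subsingleton_iff_nontrivial.1 fun _ => hA fun a =>
    ⟨0, Subsingleton.elim _ _⟩
  obtain ⟨b⟩ := e.index_nonempty
  rw [← he] at hK
  set R₀ := multiplierSubalgebra (Submodule.span S (Set.range e))
  have : Nonempty {R : Subalgebra S A // IsNice F R ∧ R ≤ R₀} :=
    ⟨⟨R₀, isNice_multiplierSubalgebra e b hK, le_rfl⟩⟩
  -- Staying below R₀ keeps both the integrality of the matrices and the covering chain available at
  -- each stage.
  have : NoMinOrder {R : Subalgebra S A // IsNice F R ∧ R ≤ R₀} := ⟨fun R => by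
    obtain ⟨s, hs, hlt⟩ := exists_conductorSubalgebra_lt hS hA e b R.2.1 R.2.2
    exact ⟨⟨_, R.2.1.conductorSubalgebra hs, hlt.le.trans R.2.2⟩, hlt⟩⟩
  obtain ⟨R, hR⟩ := Nat.exists_strictAnti {R : Subalgebra S A // IsNice F R ∧ R ≤ R₀}
  have hR' : ∀ n, IsNice F (R n).1 ∧ HasCoveringChain (R n).1 C := fun n =>
    ⟨(R n).2.1, (hasCoveringChain_multiplierSubalgebra e b hC).of_algHom
      (Subalgebra.inclusion (R n).2.2)⟩
  exact ⟨⟨(R 0).1, hR' 0⟩, fun n => (R n).1, fun _ _ h => hR h, hR'⟩
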